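/- **Theorem (Tightness).** *Model.* Fix integers $K,M\ge 1$, $d\ge 2$, an arrival rate $\lambda>0$, service rates $u_1,\dots,u_M>0$ and constants $\xi>0$, $w_1,\dots,w_K>0$, $v_1,\dots,v_M>0$ with $\lambda\xi<\sum_m u_mv_m$. For each $N\ge 1$ let $G^N=(W^N,V^N,E^N)$ be a bipartite graph with $W(N)$ dispatchers, $N$ servers and edge set $E^N\subseteq W^N\times V^N$; every dispatcher has a task type in $\{1,\dots,K\}$ and every server a server type in $\{1,\dots,M\}$. Let $W^N_k$ be the set of type-$k$ dispatchers, $V^N_m$ the set of type-$m$ servers, $\mathcal N^N_w(i)=\{j:(i,j)\in E^N\}$ and $\delta_i^N=|\mathcal N_w^N(i)|$. Assume that, as $N\to\infty$, $W(N)/N\to\xi$, $|W^N_k|/W(N)\to w_k$ and $|V^N_m|/N\to v_m$ for all $k,m$. Tasks arrive at each dispatcher as independent Poisson processes of rate $\lambda$. A task arriving at dispatcher $i$ with $\delta^N_i\ge d$ joins a shortest queue among $d$ servers sampled uniformly without replacement from $\mathcal N^N_w(i)$, with ties broken uniformly at random; if $1\le\delta^N_i<d$ it joins a uniformly chosen server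 of $\mathcal N^N_w(i)$ (if $\delta^N_i=0$ it is discarded). A type-$m$ server works at exponential rate $u_m$. Let $X^N=(X^N_j)_{j\in V^N}$ be the resulting continuous-time Markov chain of queue lengths on $\mathbb N_0^{V^N}$. With $m(j)$ the type of server $j$, put $$\rho^N=\max_{\emptyset\ne U\subseteq V^N}\Big(\sum_{j\in U}u_{m(j)}\Big)^{-1}\sum_{i\in W^N}\Big(\mathbf 1_{\{\delta^N_i\ge d\}}\,\lambda\,\frac{\binom{|U\cap\mathcal N^N_w(i)|}{d}}{\binom{\delta_i^N}{d}}+\mathbf 1_{\{\delta^N_i<d\}}\,\lambda\,\frac{|U\cap\mathcal N^N_w(i)|}{\delta_i^N}\Big)$$ (with $0/0=0$), and assume that the sequence is subcritical: $\rho^N\to\rho$ for some $\rho<1$. For a state $x$, let $q^N_{m,l}(x)=|V^N_m|^{-1}\,|\{j\in V^N_m:x_j\ge l\}|$ for $1\le m\le M$, $l\in\mathbb N_0$ (defined if every $V^N_m$ is non-empty), and let $$\mathcal S=\Big\{q\in[0,1]^{M\times\mathbb N_0}: q_{m,0}=1,\ q_{m,l}\ge q_{m,l+1},\ \sum_l q_{m,l}<\infty\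 \text{for all } m,l\Big\}$$ with the $\ell_1$-topology. *Conclusion.* For every $N\ge 1$ with $\rho^N<1$ (hence for all large $N$) the chain $X^N$ has exactly one stationary distribution. Moreover, writing $q^N(\infty)=q^N(X)$ where $X$ has a stationary distribution of $X^N$, for every $\varepsilon>0$ there is a compact set $\bar K(\varepsilon)\subseteq\mathcal S$ such that $$\mathbb P\big(q^N(\infty)\notin\bar K(\varepsilon)\big)<\varepsilon$$ for every $N\ge 1$ for which $q^N(\infty)$ is defined, that is, for which every $V^N_m$ is non-empty and $X^N$ has a stationary distribution. -/

import Mathlib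

open Filter Topology MeasureTheory
open scoped BoundedContinuousFunction ENNReal

/-- A system with `N` single-server queues (servers `Fin N`), `W` dispatchers, `K` task types and
`M` server types. `edge` is the set of compatible (dispatcher, server) pairs. -/
structure QueueSystem (K M N : ℕ) where
  W : ℕ
  taskType : Fin W → Fin K
  serverType : Fin N → Fin M
  edge : Finset (Fin W × Fin N)

namespace QueueSystem

/-- Servers that have a minimal queue length, in state `x`, among the servers in `S`. -/
def shortest {N : ℕ} (S : Finset (Fin N)) (x : Fin N → ℕ) : Finset (Fin N) :=
  S.filter fun j => ∀ j' ∈ S, x j ≤ x j'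

/-- The state after an arrival at server `j`. -/
def arrive {N : ℕ} (j : Fin N) (x : Fin N → ℕ) : Fin N → ℕ := Function.update x j (x j + 1)

/-- The state after a service completion at server `j` (used only where `0 < x j`). -/
def depart {N : ℕ} (j : Fin N) (x : Fin N → ℕ) : Fin N → ℕ := Function.update x j (x j - 1)

variable {K M N : ℕ} (G : QueueSystem K M N)

/-- The dispatchers that handle tasks of type `k`. -/
def dispatchersOf (k : Fin K) : Finset (Fin G.W) := Finset.univ.filter fun i => G.taskType i = k

/-- The servers of type `m`. -/
def serversOf (m : Fin M) : Finset (Fin N) := Finset.univ.filter fun j => G.serverType j = m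

/-- The neighborhood of dispatcher `i`: the servers that are compatible with it. -/
def nbhd (i : Fin G.W) : Finset (Fin N) := Finset.univ.filter fun j => (i, j) ∈ G.edge

/-- Local JSQ(`d`): the probability that a task which arrives at dispatcher `i` while the queue
lengths are `x` is assigned to server `j`. If `i` has at least `d` neighbors, then `d` of them are
sampled uniformly without replacement and the task joins a shortest queue among these, with
uniform tie-breaking; otherwise the task joins a uniformly chosen neighbor. (A task that has no
compatible server at all is assigned to none.) -/
noncomputable def assignProb (d : ℕ) (i : Fin G.W) (x : Fin N → ℕ) (j : Fin N) : ℝ :=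
  if d ≤ (G.nbhd i).card then
    ∑ S ∈ (G.nbhd i).powersetCard d,
      (1 / ((G.nbhd i).card.choose d : ℝ)) *
        (if j ∈ shortest S x then 1 / ((shortest S x).card : ℝ) else 0)
  else
    if j ∈ G.nbhd i then 1 / ((G.nbhd i).card : ℝ) else 0

/-- Total arrival rate at server `j` in state `x`; each dispatcher receives tasks at rate `lam`. -/
noncomputable def arrivalRate (d : ℕ) (lam : ℝ) (j : Fin N) (x : Fin N → ℕ) : ℝ :=
  ∑ i : Fin G.W, lam * G.assignProb d i x j

/-- Departure rate at server `j` in state `x`; type-`m` servers work at rate `u m`. -/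
noncomputable def departureRate (u : Fin M → ℝ) (j : Fin N) (x : Fin N → ℕ) : ℝ :=
  if 0 < x j then u (G.serverType j) else 0

theorem abs_one_div_natCast_le (n : ℕ) : |1 / (n : ℝ)| ≤ 1 := by
  rw [abs_of_nonneg (by positivity), one_div]
  exact Nat.cast_inv_le_one n

theorem abs_assignProb_le (d : ℕ) (i : Fin G.W) (x : Fin N → ℕ) (j : Fin N) :
    |G.assignProb d i x j| ≤ ((G.nbhd i).powersetCard d).card + 1 := by
  unfold assignProb
  split_ifs
  · refine (Finset.abs_sum_le_sum_abs _ _).trans ?_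
    refine (Finset.sum_le_sum (g := fun _ => (1 : ℝ)) fun S _ => ?_).trans (by simp)
    rw [abs_mul]
    refine mul_le_one₀ (abs_one_div_natCast_le _) (abs_nonneg _) ?_
    split_ifs
    · exact abs_one_div_natCast_le _
    · simp
  · exact (abs_one_div_natCast_le _).trans (by simp)
  · simpa using by positivity

/-- `arrivalRate` as a bounded function of the state. -/
noncomputable def arrivalRateBdd (d : ℕ) (lam : ℝ) (j : Fin N) : (Fin N → ℕ) →ᵇ ℝ :=
  BoundedContinuousFunction.ofNormedAddCommGroupDiscrete (G.arrivalRate d lam j)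
    (∑ i : Fin G.W, |lam| * (((G.nbhd i).powersetCard d).card + 1)) fun x => by
      rw [Real.norm_eq_abs]
      refine (Finset.abs_sum_le_sum_abs _ _).trans (Finset.sum_le_sum fun i _ => ?_)
      rw [abs_mul]
      exact mul_le_mul_of_nonneg_left (G.abs_assignProb_le d i x j) (abs_nonneg _)

/-- `departureRate` as a bounded function of the state. -/
noncomputable def departureRateBdd (u : Fin M → ℝ) (j : Fin N) : (Fin N → ℕ) →ᵇ ℝ :=
  BoundedContinuousFunction.ofNormedAddCommGroupDiscrete (G.departureRate u j)
    |u (G.serverType j)| fun x => by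
      unfold departureRate
      split_ifs <;> simp

/-- Composition with a map of the (discrete) state space, on bounded functions. -/
noncomputable def compOp (φ : (Fin N → ℕ) → (Fin N → ℕ)) :
    ((Fin N → ℕ) →ᵇ ℝ) →L[ℝ] ((Fin N → ℕ) →ᵇ ℝ) :=
  BoundedContinuousFunction.compContinuousCLM ℝ ℝ ⟨φ, continuous_of_discreteTopology⟩

/-- The generator of the queue length process, a bounded operator on the bounded functions of the
state; see `generator_apply` for its values. -/
noncomputable def generator (d : ℕ) (lam : ℝ) (u : Fin M → ℝ) :
    ((Fin N → ℕ) →ᵇ ℝ) →L[ℝ] ((Fin N → ℕ) →ᵇ ℝ) :=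
  ∑ j : Fin N,
    ((ContinuousLinearMap.mul ℝ _ (G.arrivalRateBdd d lam j)).comp
        (compOp (arrive j) - ContinuousLinearMap.id ℝ _) +
      (ContinuousLinearMap.mul ℝ _ (G.departureRateBdd u j)).comp
        (compOp (depart j) - ContinuousLinearMap.id ℝ _))

theorem generator_apply (d : ℕ) (lam : ℝ) (u : Fin M → ℝ) (f : (Fin N → ℕ) →ᵇ ℝ)
    (x : Fin N → ℕ) :
    G.generator d lam u f x =
      ∑ j : Fin N, (G.arrivalRate d lam j x * (f (arrive j x) - f x) +
        G.departureRate u j x * (f (depart j x) - f x)) := by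
  simp [generator, arrivalRateBdd, departureRateBdd, compOp,
    BoundedContinuousFunction.sum_apply, mul_sub]

/-- The exponential `∑ₙ Aⁿ / n!` of a bounded operator. -/
noncomputable def operatorExp {E : Type*} [NormedAddCommGroup E] [NormedSpace ℝ E]
    (A : E →L[ℝ] E) : E →L[ℝ] E :=
  NormedSpace.exp A

/-- The transition semigroup of the queue length process `(X(t))`, a continuous-time Markov chain
with bounded jump rates: `G.semigroup d lam u t f x` is the expectation of `f (X(t))` when
`X(0) = x`. -/
noncomputable def semigroup (d : ℕ) (lam : ℝ) (u : Fin M → ℝ) (t : ℝ) :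
    ((Fin N → ℕ) →ᵇ ℝ) →L[ℝ] ((Fin N → ℕ) →ᵇ ℝ) :=
  operatorExp (t • G.generator d lam u)

/-- `π` is a stationary distribution (a steady state law) of the queue length process: if `X(0)`
has law `π`, then so has `X(t)` for every `t ≥ 0`. -/
def IsStationary (d : ℕ) (lam : ℝ) (u : Fin M → ℝ) (π : Measure (Fin N → ℕ)) : Prop :=
  IsProbabilityMeasure π ∧
    ∀ t : ℝ, 0 ≤ t → ∀ f : (Fin N → ℕ) →ᵇ ℝ,
      ∫ x, G.semigroup d lam u t f x ∂π = ∫ x, f x ∂π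

/-- The load `ρ^N`: the maximum over the nonempty sets `U` of servers of the rate at which tasks
are necessarily assigned to `U` when the queues in `U` are the long ones, divided by the total
service rate of `U`. -/
noncomputable def load (d : ℕ) (lam : ℝ) (u : Fin M → ℝ) : ℝ :=
  ⨆ U : {U : Finset (Fin N) // U.Nonempty},
    (∑ j ∈ U.1, u (G.serverType j))⁻¹ *
      ∑ i : Fin G.W,
        if d ≤ (G.nbhd i).card then
          ∑ _S ∈ (U.1 ∩ G.nbhd i).powersetCard d, lam / ((G.nbhd i).card.choose d : ℝ)
        else lam * ((U.1 ∩ G.nbhd i).card : ℝ) / ((G.nbhd i).card : ℝ)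

/-- The proportion of type-`m` servers with queue length at least `l`, in state `x`
(meaningful if there is a type-`m` server). -/
noncomputable def tailFraction (x : Fin N → ℕ) (m : Fin M) (l : ℕ) : ℝ :=
  (1 / ((G.serversOf m).card : ℝ)) * ∑ j ∈ G.serversOf m, if l ≤ x j then 1 else 0

theorem tailFraction_memℓp (x : Fin N → ℕ) :
    Memℓp (fun ml : Fin M × ℕ => G.tailFraction x ml.1 ml.2) 1 := by
  refine (memℓp_zero ?_).of_exponent_ge zero_le
  refine (Set.finite_univ.prod (Set.finite_Iic (∑ j, x j))).subset ?_
  rintro ⟨m, l⟩ h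
  simp only [Set.mem_prod, Set.mem_univ, true_and, Set.mem_Iic]
  by_contra! hl
  refine h ?_
  have h0 : ∀ j ∈ G.serversOf m, (if l ≤ x j then (1 : ℝ) else 0) = 0 := fun j _ =>
    if_neg (not_le.2 ((Finset.single_le_sum (fun _ _ => Nat.zero_le _)
      (Finset.mem_univ j)).trans_lt hl))
  simp [tailFraction, Finset.sum_eq_zero h0]

/-- The global occupancy `q = (q_{m,l})` of the state `x`, as an element of `ℓ¹`. -/
noncomputable def occupancy (x : Fin N → ℕ) : lp (fun _ : Fin M × ℕ => ℝ) 1 :=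
  ⟨fun ml => G.tailFraction x ml.1 ml.2, G.tailFraction_memℓp x⟩

end QueueSystem

/-- The space `𝒮` of occupancy states inside `ℓ¹(Fin M × ℕ)`; the condition `∑_l q_{m,l} < ∞` is
membership in `ℓ¹`, and the topology is that of the `ℓ¹` norm. -/
def occupancySpace (M : ℕ) : Set (lp (fun _ : Fin M × ℕ => ℝ) 1) :=
  {q | ∀ m : Fin M, q (m, 0) = 1 ∧ ∀ l : ℕ, q (m, l) ∈ Set.Icc (0 : ℝ) 1 ∧ q (m, l + 1) ≤ q (m, l)}

namespace QueueSystem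

variable {K M N : ℕ} (G : QueueSystem K M N)

/-! ### Rates -/

/-! Let `longRate l` be the total service rate of the servers with queue at least `l`. Under
JSQ(`d`) a task joins such a server only if its whole sample consists of such servers; a dispatcher
with fewer than `d` neighbors hits them in proportion to their number. Hence these servers receive
tasks at rate at most `load * longRate l` (`sum_arrivalRate_longQueues_le`), and the total excess of
the queues over `l` has drift at most `load * longRate l - longRate (l + 1)`. In the steady state a
drift has mean zero, so the mean of `longRate l` is at most `(∑ j, u) * r ^ l` for any nonnegative
`r ≥ load` (`IsStationary.integral_longRate_le`).

For large `N` the total service rate is at most of order `N` and every type has at least `κ * N`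
servers, so Markov's inequality gives tails of the occupancy that decay geometrically, uniformly in
`N`. A summable envelope cuts out a compact subset of `ℓ¹` (`isCompact_occupancyBox`); the finitely
many remaining `N` each get a finite set of occupancies.

Existence uses the same drift bound on time averages of the uniformized chain from the empty state:
they are tight, so a limit is a stationary law. Uniqueness holds because departures lead from every
state to the empty one. -/

theorem assignProb_nonneg (d : ℕ) (i : Fin G.W) (x : Fin N → ℕ) (j : Fin N) :
    0 ≤ G.assignProb d i x j := by
  unfold assignProb
  split_ifs
  · refine Finset.sum_nonneg fun S _ => mul_nonneg (by positivity) ?_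
    split_ifs <;> positivity
  · positivity
  · exact le_rfl

theorem arrivalRate_nonneg {d : ℕ} {lam : ℝ} (hlam : 0 ≤ lam) (j : Fin N) (x : Fin N → ℕ) :
    0 ≤ G.arrivalRate d lam j x :=
  Finset.sum_nonneg fun i _ => mul_nonneg hlam (G.assignProb_nonneg d i x j)

theorem departureRate_nonneg {u : Fin M → ℝ} (hu : ∀ m, 0 < u m) (j : Fin N) (x : Fin N → ℕ) :
    0 ≤ G.departureRate u j x := by
  unfold departureRate
  split_ifs
  exacts [(hu _).le, le_rfl]

/-- The servers with queue length at least `l`. -/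
def longQueues (l : ℕ) (x : Fin N → ℕ) : Finset (Fin N) := Finset.univ.filter fun j => l ≤ x j

/-- If a shortest queue in `S` has length at least `l`, then so has every queue in `S`. The
tie-breaking weights sum to 1, or to 0 when `S` is empty. -/
theorem sum_shortest_le (S : Finset (Fin N)) (x : Fin N → ℕ) (l : ℕ) :
    ∑ j ∈ longQueues l x, (if j ∈ shortest S x then 1 / ((shortest S x).card : ℝ) else 0) ≤
      if S ⊆ longQueues l x then 1 else 0 := by
  split_ifs with h
  · calc _ ≤ ∑ j, (if j ∈ shortest S x then 1 / ((shortest S x).card : ℝ) else 0) :=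
          Finset.sum_le_univ_sum_of_nonneg fun j => by split_ifs <;> positivity
      _ = (shortest S x).card * (1 / ((shortest S x).card : ℝ)) := by
          rw [← Finset.sum_filter, Finset.sum_const, nsmul_eq_mul]
          simp
      _ ≤ 1 := by
          rw [mul_one_div]
          exact div_self_le_one _
  · refine le_of_eq (Finset.sum_eq_zero fun j hj => if_neg fun hjS => h fun j' hj' => ?_)
    simp only [longQueues, shortest, Finset.mem_filter, Finset.mem_univ, true_and] at hj hjS ⊢
    exact hj.trans (hjS.2 j' hj')

theorem sum_assignProb_longQueues_le (d : ℕ) (i : Fin G.W) (x : Fin N → ℕ) (l : ℕ) :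
    ∑ j ∈ longQueues l x, G.assignProb d i x j ≤
      if d ≤ (G.nbhd i).card then
        ∑ _S ∈ (longQueues l x ∩ G.nbhd i).powersetCard d, 1 / ((G.nbhd i).card.choose d : ℝ)
      else ((longQueues l x ∩ G.nbhd i).card : ℝ) / ((G.nbhd i).card : ℝ) := by
  unfold assignProb
  split_ifs
  · rw [Finset.sum_comm]
    simp_rw [← Finset.mul_sum]
    refine (mul_le_mul_of_nonneg_left (Finset.sum_le_sum fun S _ => sum_shortest_le S x l)
      (by positivity)).trans (le_of_eq ?_)
    simp_rw [Finset.mul_sum, mul_ite, mul_one, mul_zero]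
    rw [← Finset.sum_filter]
    refine Finset.sum_congr ?_ fun _ _ => rfl
    ext S
    simp only [Finset.mem_filter, Finset.mem_powersetCard, Finset.subset_inter_iff]
    tauto
  · rw [← Finset.sum_filter, Finset.sum_const, nsmul_eq_mul, mul_one_div,
      Finset.filter_mem_eq_inter]

/-- The total service rate of the servers with queue length at least `l`. -/
noncomputable def longRate (u : Fin M → ℝ) (l : ℕ) (x : Fin N → ℕ) : ℝ :=
  ∑ j ∈ longQueues l x, u (G.serverType j)

theorem longRate_nonneg {u : Fin M → ℝ} (hu : ∀ m, 0 < u m) (l : ℕ) (x : Fin N → ℕ) :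
    0 ≤ G.longRate u l x :=
  Finset.sum_nonneg fun _ _ => (hu _).le

theorem longRate_le {u : Fin M → ℝ} (hu : ∀ m, 0 < u m) (l : ℕ) (x : Fin N → ℕ) :
    G.longRate u l x ≤ ∑ j, u (G.serverType j) :=
  Finset.sum_le_univ_sum_of_nonneg fun _ => (hu _).le

/-- The load is a supremum over sets `U`; the set of long queues is one of them. -/
theorem sum_arrivalRate_longQueues_le {d : ℕ} {lam : ℝ} (hlam : 0 ≤ lam) {u : Fin M → ℝ}
    (hu : ∀ m, 0 < u m) (l : ℕ) (x : Fin N → ℕ) :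
    ∑ j ∈ longQueues l x, G.arrivalRate d lam j x ≤ G.load d lam u * G.longRate u l x := by
  rcases (longQueues l x).eq_empty_or_nonempty with h | h
  · simp [longRate, h]
  have hpos : 0 < G.longRate u l x := Finset.sum_pos (fun _ _ => hu _) h
  rw [← div_le_iff₀ hpos, div_eq_inv_mul]
  refine le_trans ?_ (le_ciSup (Set.finite_range _).bddAbove
    (⟨longQueues l x, h⟩ : {U : Finset (Fin N) // U.Nonempty}))
  refine mul_le_mul_of_nonneg_left ?_ (inv_nonneg.2 hpos.le)
  unfold arrivalRate
  rw [Finset.sum_comm]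
  refine Finset.sum_le_sum fun i _ => ?_
  rw [← Finset.mul_sum]
  refine (mul_le_mul_of_nonneg_left (G.sum_assignProb_longQueues_le d i x l) hlam).trans
    (le_of_eq ?_)
  split_ifs
  · rw [Finset.mul_sum]
    simp_rw [mul_one_div]
  · rw [mul_div_assoc]

/-! ### The generator on arbitrary functions -/

/-- The generator as a linear map on all functions of the state. -/
noncomputable def rateOp (d : ℕ) (lam : ℝ) (u : Fin M → ℝ) :
    ((Fin N → ℕ) → ℝ) →ₗ[ℝ] ((Fin N → ℕ) → ℝ) where
  toFun f x := ∑ j : Fin N, (G.arrivalRate d lam j x * (f (arrive j x) - f x) +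
        G.departureRate u j x * (f (depart j x) - f x))
  map_add' f g := by
    funext x
    simp only [Pi.add_apply, ← Finset.sum_add_distrib]
    exact Finset.sum_congr rfl fun _ _ => by ring
  map_smul' c f := by
    funext x
    simp only [Pi.smul_apply, smul_eq_mul, RingHom.id_apply, Finset.mul_sum]
    exact Finset.sum_congr rfl fun _ _ => by ring

theorem rateOp_apply (d : ℕ) (lam : ℝ) (u : Fin M → ℝ) (f : (Fin N → ℕ) → ℝ) (x : Fin N → ℕ) :
    G.rateOp d lam u f x = ∑ j : Fin N, (G.arrivalRate d lam j x * (f (arrive j x) - f x) +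
        G.departureRate u j x * (f (depart j x) - f x)) := rfl

theorem coe_generator (d : ℕ) (lam : ℝ) (u : Fin M → ℝ) (f : (Fin N → ℕ) →ᵇ ℝ) :
    ⇑(G.generator d lam u f) = G.rateOp d lam u f := by
  funext x
  rw [generator_apply, rateOp_apply]

theorem sum_arrive_sub (g : ℕ → ℝ) (j : Fin N) (x : Fin N → ℕ) :
    ∑ k, g (arrive j x k) - ∑ k, g (x k) = g (x j + 1) - g (x j) := by
  rw [← Finset.sum_sub_distrib, Finset.sum_eq_single j]
  · simp [arrive]
  · intro k _ hk
    simp [arrive, Function.update_of_ne hk]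
  · simp

theorem sum_depart_sub (g : ℕ → ℝ) (j : Fin N) (x : Fin N → ℕ) :
    ∑ k, g (depart j x k) - ∑ k, g (x k) = g (x j - 1) - g (x j) := by
  rw [← Finset.sum_sub_distrib, Finset.sum_eq_single j]
  · simp [depart]
  · intro k _ hk
    simp [depart, Function.update_of_ne hk]
  · simp

theorem rateOp_sum (d : ℕ) (lam : ℝ) (u : Fin M → ℝ) (g : ℕ → ℝ) (x : Fin N → ℕ) :
    G.rateOp d lam u (fun x => ∑ j, g (x j)) x =
      ∑ j : Fin N, (G.arrivalRate d lam j x * (g (x j + 1) - g (x j)) +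
        G.departureRate u j x * (g (x j - 1) - g (x j))) := by
  simp only [rateOp_apply, sum_arrive_sub, sum_depart_sub]

/-- The total excess of the queue lengths over `l`. -/
def excess (l : ℕ) (x : Fin N → ℕ) : ℝ := ∑ j, ((x j - l : ℕ) : ℝ)

/-- The total excess of the queue lengths over `l`, each counted up to `R`. -/
def cappedExcess (l R : ℕ) (x : Fin N → ℕ) : ℝ := ∑ j, ((min (x j - l) R : ℕ) : ℝ)

/-- An arrival raises the excess by one exactly when `l ≤ x j`, a departure lowers it by one exactly
when `l + 1 ≤ x j`. -/
theorem rateOp_excess_le {d : ℕ} {lam : ℝ} (hlam : 0 ≤ lam) {u : Fin M → ℝ}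
    (hu : ∀ m, 0 < u m) (l : ℕ) (x : Fin N → ℕ) :
    G.rateOp d lam u (excess l) x ≤
      G.load d lam u * G.longRate u l x - G.longRate u (l + 1) x := by
  refine le_trans (le_of_eq ?_) (sub_le_sub_right (G.sum_arrivalRate_longQueues_le hlam hu l x) _)
  unfold excess
  rw [G.rateOp_sum d lam u (fun n => ((n - l : ℕ) : ℝ))]
  unfold longRate longQueues
  rw [Finset.sum_filter, Finset.sum_filter, ← Finset.sum_sub_distrib]
  refine Finset.sum_congr rfl fun j _ => ?_
  unfold departureRate
  rcases lt_trichotomy l (x j) with h | h | h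
  · obtain ⟨k, hk⟩ := Nat.exists_eq_add_of_lt h
    have h1 : x j + 1 - l = k + 2 := by omega
    have h2 : x j - l = k + 1 := by omega
    have h3 : x j - 1 - l = k := by omega
    rw [h1, h2, h3, if_pos h.le, if_pos (by omega), if_pos (by omega)]
    push_cast
    ring
  · have h1 : x j + 1 - l = 1 := by omega
    have h2 : x j - l = 0 := by omega
    have h3 : x j - 1 - l = 0 := by omega
    rw [h1, h2, h3, if_pos h.le, if_neg (by omega : ¬ l + 1 ≤ x j)]
    simp
  · have h1 : x j + 1 - l = 0 := by omega
    have h2 : x j - l = 0 := by omega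
    have h3 : x j - 1 - l = 0 := by omega
    rw [h1, h2, h3, if_neg (by omega : ¬ l ≤ x j), if_neg (by omega : ¬ l + 1 ≤ x j)]
    simp

/-- Stationarity can be tested only on bounded functions, hence the cap. Departures from queues
above `l + R` no longer lower the sum, which costs the last term. -/
theorem rateOp_cappedExcess_le {d : ℕ} {lam : ℝ} (hlam : 0 ≤ lam) {u : Fin M → ℝ}
    (hu : ∀ m, 0 < u m) (l R : ℕ) (x : Fin N → ℕ) :
    G.rateOp d lam u (cappedExcess l R) x ≤
      G.load d lam u * G.longRate u l x - G.longRate u (l + 1) x + G.longRate u (l + R + 1) x := by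
  refine le_trans ?_ (add_le_add_left
    (sub_le_sub_right (G.sum_arrivalRate_longQueues_le (d := d) hlam hu l x) _) _)
  unfold cappedExcess
  rw [G.rateOp_sum d lam u (fun n => ((min (n - l) R : ℕ) : ℝ))]
  unfold longRate longQueues
  rw [Finset.sum_filter, Finset.sum_filter, Finset.sum_filter, ← Finset.sum_sub_distrib,
    ← Finset.sum_add_distrib]
  refine Finset.sum_le_sum fun j _ => ?_
  have ha := G.arrivalRate_nonneg (d := d) hlam j x
  unfold departureRate
  rcases lt_or_ge (x j) l with h | h
  · have h1 : x j + 1 - l = 0 := by omega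
    have h2 : x j - l = 0 := by omega
    have h3 : x j - 1 - l = 0 := by omega
    rw [h1, h2, h3, if_neg (by omega : ¬ l ≤ x j), if_neg (by omega : ¬ l + 1 ≤ x j),
      if_neg (by omega : ¬ l + R + 1 ≤ x j)]
    simp
  obtain ⟨k, hk⟩ := Nat.exists_eq_add_of_le h
  have h1 : x j + 1 - l = k + 1 := by omega
  have h2 : x j - l = k := by omega
  have h3 : x j - 1 - l = k - 1 := by omega
  rw [h1, h2, h3, if_pos h]
  rcases Nat.eq_zero_or_pos k with rfl | hk0
  · rw [if_neg (by omega : ¬ l + 1 ≤ x j), if_neg (by omega : ¬ l + R + 1 ≤ x j)]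
    have : ((min (0 + 1) R : ℕ) : ℝ) ≤ 1 := by exact_mod_cast min_le_left _ _
    simp only [Nat.zero_min, Nat.cast_zero, sub_zero, zero_tsub, mul_zero, add_zero]
    exact mul_le_of_le_one_right ha this
  rw [if_pos (by omega : l + 1 ≤ x j), if_pos (by omega : 0 < x j)]
  rcases le_or_gt k R with hkR | hkR
  · rw [if_neg (by omega : ¬ l + R + 1 ≤ x j), min_eq_left hkR, min_eq_left (by omega : k - 1 ≤ R),
      Nat.cast_sub hk0]
    have : ((min (k + 1) R : ℕ) : ℝ) ≤ k + 1 := by exact_mod_cast min_le_left _ _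
    have := mul_le_of_le_one_right ha (by linarith : ((min (k + 1) R : ℕ) : ℝ) - k ≤ 1)
    simp only [Nat.cast_one]
    linarith
  · rw [if_pos (by omega : l + R + 1 ≤ x j), min_eq_right hkR.le,
      min_eq_right (by omega : R ≤ k - 1), min_eq_right (by omega : R ≤ k + 1)]
    simpa using ha

/-! ### Stationarity and the generator -/

/-- Integration against a probability measure, as a continuous functional on bounded functions. -/
noncomputable def integralCLM (π : Measure (Fin N → ℕ)) [IsProbabilityMeasure π] :
    ((Fin N → ℕ) →ᵇ ℝ) →L[ℝ] ℝ :=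
  LinearMap.mkContinuous
    { toFun := fun f => ∫ x, f x ∂π
      map_add' := fun f g => integral_add (f.integrable π) (g.integrable π)
      map_smul' := fun c f => integral_const_mul c _ } 1 fun f => by
    simpa using f.norm_integral_le_norm π

theorem integralCLM_apply (π : Measure (Fin N → ℕ)) [IsProbabilityMeasure π]
    (f : (Fin N → ℕ) →ᵇ ℝ) : integralCLM π f = ∫ x, f x ∂π := rfl

theorem hasDerivAt_integral_semigroup (d : ℕ) (lam : ℝ) (u : Fin M → ℝ)
    (π : Measure (Fin N → ℕ)) [IsProbabilityMeasure π] (f : (Fin N → ℕ) →ᵇ ℝ) (t : ℝ) :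
    HasDerivAt (fun t => integralCLM π (G.semigroup d lam u t f))
      (integralCLM π (G.generator d lam u (G.semigroup d lam u t f))) t := by
  have h : HasDerivAt (fun t => G.semigroup d lam u t)
      (G.generator d lam u * G.semigroup d lam u t) t :=
    hasDerivAt_exp_smul_const' (𝕂 := ℝ) (G.generator d lam u) t
  have h1 := h.clm_apply (hasDerivAt_const t f)
  rw [map_zero, add_zero] at h1
  exact (integralCLM π).hasFDerivAt.comp_hasDerivAt t h1

theorem semigroup_zero (d : ℕ) (lam : ℝ) (u : Fin M → ℝ) : G.semigroup d lam u 0 = 1 := by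
  simp [semigroup, operatorExp]

theorem IsStationary.integral_generator {d : ℕ} {lam : ℝ} {u : Fin M → ℝ}
    {π : Measure (Fin N → ℕ)} (h : G.IsStationary d lam u π) (f : (Fin N → ℕ) →ᵇ ℝ) :
    ∫ x, G.generator d lam u f x ∂π = 0 := by
  have := h.1
  -- Invariance is known only for `t ≥ 0`, so derivatives at 0 are compared within the half-line.
  have h1 := (G.hasDerivAt_integral_semigroup d lam u π f 0).hasDerivWithinAt (s := Set.Ici 0)
  have h2 : HasDerivWithinAt (fun t => integralCLM π (G.semigroup d lam u t f)) 0
      (Set.Ici 0) 0 :=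
    (hasDerivWithinAt_const (0 : ℝ) (Set.Ici 0) (integralCLM π f)).congr
      (fun t ht => h.2 t ht f) (h.2 0 le_rfl f)
  have h3 := (uniqueDiffOn_Ici (0 : ℝ) 0 Set.self_mem_Ici).eq_deriv _ h1 h2
  rwa [semigroup_zero] at h3

/-- The derivative of `∫ semigroup t f` is the integral of the generator applied to the bounded
function `semigroup t f`, so it vanishes. -/
theorem isStationary_of_integral_generator {d : ℕ} {lam : ℝ} {u : Fin M → ℝ}
    {π : Measure (Fin N → ℕ)} [IsProbabilityMeasure π]
    (h : ∀ f, ∫ x, G.generator d lam u f x ∂π = 0) : G.IsStationary d lam u π := by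
  refine ⟨inferInstance, fun t _ f => ?_⟩
  have hd := G.hasDerivAt_integral_semigroup d lam u π f
  have := is_const_of_deriv_eq_zero (fun t => (hd t).differentiableAt)
    (fun t => (hd t).deriv.trans (h _)) t 0
  simpa [semigroup_zero, integralCLM_apply] using this

/-! ### Uniqueness of the stationary distribution -/

/-- A bounded function of the state, as a bounded continuous function. -/
def ofBounded (f : (Fin N → ℕ) → ℝ) (c : ℝ) (hf : ∀ x, |f x| ≤ c) : (Fin N → ℕ) →ᵇ ℝ :=
  BoundedContinuousFunction.ofNormedAddCommGroupDiscrete f c hf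

theorem coe_ofBounded (f : (Fin N → ℕ) → ℝ) (c : ℝ) (hf : ∀ x, |f x| ≤ c) :
    ⇑(ofBounded f c hf) = f := rfl

theorem IsStationary.integral_rateOp {d : ℕ} {lam : ℝ} {u : Fin M → ℝ}
    {π : Measure (Fin N → ℕ)} (h : G.IsStationary d lam u π) {f : (Fin N → ℕ) → ℝ} {c : ℝ}
    (hf : ∀ x, |f x| ≤ c) :
    Integrable (G.rateOp d lam u f) π ∧ ∫ x, G.rateOp d lam u f x ∂π = 0 := by
  have := h.1
  have h1 := h.integral_generator G (ofBounded f c hf)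
  have h2 := (G.generator d lam u (ofBounded f c hf)).integrable π
  rw [coe_generator, coe_ofBounded] at h1 h2
  exact ⟨h2, h1⟩

/-- Each departure lowers the total queue length, until the system is empty. -/
theorem mem_of_depart_closed {S : Set (Fin N → ℕ)}
    (hS : ∀ x ∈ S, ∀ j, 0 < x j → depart j x ∈ S) (x : Fin N → ℕ) (hx : x ∈ S) :
    (0 : Fin N → ℕ) ∈ S := by
  induction hn : ∑ j, x j using Nat.strong_induction_on generalizing x with
  | _ n ih =>
    by_cases h : ∃ j, 0 < x j
    · obtain ⟨j, hj⟩ := h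
      refine ih (∑ k, depart j x k) ?_ _ (hS x hx j hj) rfl
      rw [← hn]
      refine Finset.sum_lt_sum (fun k _ => ?_) ⟨j, Finset.mem_univ j, ?_⟩
      · by_cases hk : k = j
        · subst hk
          simp [depart]
        · simp [depart, Function.update_of_ne hk]
      · simpa [depart] using hj
    · push Not at h
      rwa [show (0 : Fin N → ℕ) = x from funext fun j => (Nat.le_zero.1 (h j)).symm]

theorem hasSum_measureReal_singleton_mul {π : Measure (Fin N → ℕ)} {f : (Fin N → ℕ) → ℝ}
    (hf : Integrable f π) : HasSum (fun x => π.real {x} * f x) (∫ x, f x ∂π) := by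
  have h := hasSum_integral_iUnion (μ := π) (f := f) (s := fun x : Fin N → ℕ => {x})
    (fun x => measurableSet_singleton x)
    (fun x y hxy => Set.disjoint_singleton.2 hxy) hf.integrableOn
  simpa only [Set.iUnion_of_singleton, Measure.restrict_univ, integral_singleton,
    smul_eq_mul] using h

/-- The indicator is maximal on `S`, so all terms of the generator at `x` are nonpositive and must
vanish one by one; a departure from a nonempty queue has positive rate. -/
theorem depart_mem_of_rateOp_indicator_eq_zero {d : ℕ} {lam : ℝ} (hlam : 0 ≤ lam)
    {u : Fin M → ℝ} (hu : ∀ m, 0 < u m) {S : Set (Fin N → ℕ)} {x : Fin N → ℕ} (hx : x ∈ S)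
    (h : G.rateOp d lam u (S.indicator 1) x = 0) {j : Fin N} (hj : 0 < x j) : depart j x ∈ S := by
  rw [rateOp_apply] at h
  have hle : ∀ y, S.indicator (1 : (Fin N → ℕ) → ℝ) y - S.indicator 1 x ≤ 0 := fun y => by
    rw [Set.indicator_of_mem hx]
    exact sub_nonpos.2 (Set.indicator_le_self' (fun _ _ => zero_le_one) y)
  have ha : ∀ j, G.arrivalRate d lam j x *
      (S.indicator (1 : (Fin N → ℕ) → ℝ) (arrive j x) - S.indicator 1 x) ≤ 0 := fun j =>
    mul_nonpos_of_nonneg_of_nonpos (G.arrivalRate_nonneg hlam j x) (hle _)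
  have hd : ∀ j, G.departureRate u j x *
      (S.indicator (1 : (Fin N → ℕ) → ℝ) (depart j x) - S.indicator 1 x) ≤ 0 := fun j =>
    mul_nonpos_of_nonneg_of_nonpos (G.departureRate_nonneg hu j x) (hle _)
  have hz := (Finset.sum_eq_zero_iff_of_nonpos fun j _ => add_nonpos (ha j) (hd j)).1 h j
    (Finset.mem_univ j)
  have hz' : G.departureRate u j x *
      (S.indicator (1 : (Fin N → ℕ) → ℝ) (depart j x) - S.indicator 1 x) = 0 := by
    linarith [ha j, hd j]
  by_contra hn
  rw [Set.indicator_of_mem hx, Set.indicator_of_notMem hn, departureRate, if_pos hj] at hz'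
  have := hu (G.serverType j)
  simp only [Pi.one_apply] at hz'
  linarith

theorem rateOp_indicator_nonpos {d : ℕ} {lam : ℝ} (hlam : 0 ≤ lam) {u : Fin M → ℝ}
    (hu : ∀ m, 0 < u m) {S : Set (Fin N → ℕ)} {x : Fin N → ℕ} (hx : x ∈ S) :
    G.rateOp d lam u (S.indicator 1) x ≤ 0 := by
  have hle : ∀ y, S.indicator (1 : (Fin N → ℕ) → ℝ) y - S.indicator 1 x ≤ 0 := fun y => by
    rw [Set.indicator_of_mem hx]
    exact sub_nonpos.2 (Set.indicator_le_self' (fun _ _ => zero_le_one) y)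
  rw [rateOp_apply]
  exact Finset.sum_nonpos fun j _ => add_nonpos
    (mul_nonpos_of_nonneg_of_nonpos (G.arrivalRate_nonneg hlam j x) (hle _))
    (mul_nonpos_of_nonneg_of_nonpos (G.departureRate_nonneg hu j x) (hle _))

theorem rateOp_indicator_nonneg {d : ℕ} {lam : ℝ} (hlam : 0 ≤ lam) {u : Fin M → ℝ}
    (hu : ∀ m, 0 < u m) {S : Set (Fin N → ℕ)} {x : Fin N → ℕ} (hx : x ∉ S) :
    0 ≤ G.rateOp d lam u (S.indicator 1) x := by
  have hle : ∀ y, 0 ≤ S.indicator (1 : (Fin N → ℕ) → ℝ) y - S.indicator 1 x := fun y => by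
    rw [Set.indicator_of_notMem hx, sub_zero]
    exact Set.indicator_nonneg (fun _ _ => zero_le_one) y
  rw [rateOp_apply]
  exact Finset.sum_nonneg fun j _ => add_nonneg
    (mul_nonneg (G.arrivalRate_nonneg hlam j x) (hle _))
    (mul_nonneg (G.departureRate_nonneg hu j x) (hle _))

/-- If one stationary distribution puts more mass than another one on some state, then it does so
on the empty state. -/
theorem IsStationary.real_singleton_zero_lt {d : ℕ} {lam : ℝ} (hlam : 0 ≤ lam) {u : Fin M → ℝ}
    (hu : ∀ m, 0 < u m) {π₁ π₂ : Measure (Fin N → ℕ)} (h₁ : G.IsStationary d lam u π₁)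
    (h₂ : G.IsStationary d lam u π₂) {x₀ : Fin N → ℕ} (hx₀ : π₂.real {x₀} < π₁.real {x₀}) :
    π₂.real {0} < π₁.real {0} := by
  set S : Set (Fin N → ℕ) := {x | π₂.real {x} < π₁.real {x}}
  have hb : ∀ x, |S.indicator (1 : (Fin N → ℕ) → ℝ) x| ≤ 1 := fun x => by
    by_cases hx : x ∈ S <;> simp [hx]
  obtain ⟨i₁, e₁⟩ := h₁.integral_rateOp G hb
  obtain ⟨i₂, e₂⟩ := h₂.integral_rateOp G hb
  have hsum := (hasSum_measureReal_singleton_mul i₂).sub (hasSum_measureReal_singleton_mul i₁)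
  rw [e₁, e₂, sub_zero] at hsum
  -- The terms are `(π₂ - π₁) {x} * rateOp 1_S x`; both factors are nonpositive on `S` and
  -- nonnegative off it. A zero sum kills every term, so `S` is closed under departures.
  have hz := (hasSum_zero_iff_of_nonneg fun x => ?_).1 hsum
  · refine mem_of_depart_closed (S := S) (fun x hx j hj => ?_) x₀ hx₀
    refine G.depart_mem_of_rateOp_indicator_eq_zero (d := d) hlam hu hx ?_ hj
    have h := congrFun hz x
    simp only [← sub_mul, Pi.zero_apply] at h
    exact (mul_eq_zero.1 h).resolve_left (sub_neg.2 hx).ne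
  · simp only [← sub_mul]
    by_cases hx : x ∈ S
    · exact mul_nonneg_of_nonpos_of_nonpos (sub_neg.2 hx).le
        (G.rateOp_indicator_nonpos hlam hu hx)
    · exact mul_nonneg (sub_nonneg.2 (not_lt.1 hx)) (G.rateOp_indicator_nonneg hlam hu hx)

/-- Two laws cannot each exceed the other at the empty state, so one dominates the other pointwise;
equal total mass then forces equality. -/
theorem IsStationary.eq {d : ℕ} {lam : ℝ} (hlam : 0 ≤ lam) {u : Fin M → ℝ}
    (hu : ∀ m, 0 < u m) {π₁ π₂ : Measure (Fin N → ℕ)} (h₁ : G.IsStationary d lam u π₁)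
    (h₂ : G.IsStationary d lam u π₂) : π₁ = π₂ := by
  have := h₁.1
  have := h₂.1
  have key : ∀ {p q : Measure (Fin N → ℕ)} [IsProbabilityMeasure p] [IsProbabilityMeasure q],
      (∀ x, p.real {x} ≤ q.real {x}) → p = q := by
    intro p q _ _ hpq
    have hs := (hasSum_measureReal_singleton_mul (integrable_const (μ := q) (1 : ℝ))).sub
      (hasSum_measureReal_singleton_mul (integrable_const (μ := p) (1 : ℝ)))
    simp only [mul_one, integral_const, probReal_univ, smul_eq_mul, sub_self] at hs
    refine ext_iff_measureReal_singleton.2 fun x => ?_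
    have := congrFun ((hasSum_zero_iff_of_nonneg fun x => sub_nonneg.2 (hpq x)).1 hs) x
    exact (sub_eq_zero.1 this).symm
  by_cases h : ∃ x, π₂.real {x} < π₁.real {x}
  · obtain ⟨x, hx⟩ := h
    refine (key fun y => not_lt.1 fun hy => ?_).symm
    exact (h₁.real_singleton_zero_lt G hlam hu h₂ hx).asymm
      (h₂.real_singleton_zero_lt G hlam hu h₁ hy)
  · push Not at h
    exact key h

/-! ### Geometric decay of the long queues in the steady state -/

theorem abs_longRate_le {u : Fin M → ℝ} (hu : ∀ m, 0 < u m) (l : ℕ) (x : Fin N → ℕ) :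
    |G.longRate u l x| ≤ ∑ j, u (G.serverType j) := by
  rw [abs_of_nonneg (G.longRate_nonneg hu l x)]
  exact G.longRate_le hu l x

theorem integrable_longRate {u : Fin M → ℝ} (hu : ∀ m, 0 < u m) (l : ℕ)
    (π : Measure (Fin N → ℕ)) [IsProbabilityMeasure π] : Integrable (G.longRate u l) π :=
  (ofBounded (G.longRate u l) _ (G.abs_longRate_le hu l)).integrable π

theorem tendsto_longRate (u : Fin M → ℝ) (x : Fin N → ℕ) :
    Tendsto (fun l => G.longRate u l x) atTop (𝓝 0) := by
  refine tendsto_const_nhds.congr' ?_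
  filter_upwards [eventually_gt_atTop (∑ j, x j)] with l hl
  refine (Finset.sum_eq_zero fun j hj => absurd (Finset.mem_filter.1 hj).2 (not_le.2 ?_)).symm
  exact (Finset.single_le_sum (fun _ _ => Nat.zero_le _) (Finset.mem_univ j)).trans_lt hl

theorem tendsto_integral_longRate {u : Fin M → ℝ} (hu : ∀ m, 0 < u m)
    (π : Measure (Fin N → ℕ)) [IsProbabilityMeasure π] :
    Tendsto (fun l => ∫ x, G.longRate u l x ∂π) atTop (𝓝 0) := by
  have := tendsto_integral_of_dominated_convergence (μ := π)
    (F := fun l => G.longRate u l) (f := fun _ => 0) (fun _ => ∑ j, u (G.serverType j))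
    (fun l => (G.integrable_longRate hu l π).aestronglyMeasurable) (integrable_const _)
    (fun l => ae_of_all _ fun x => G.abs_longRate_le hu l x)
    (ae_of_all _ fun x => G.tendsto_longRate u x)
  simpa using this

/-- The capped excess has mean drift zero, and the cost of the cap vanishes as `R → ∞`. -/
theorem IsStationary.integral_longRate_succ_le {d : ℕ} {lam : ℝ} (hlam : 0 ≤ lam)
    {u : Fin M → ℝ} (hu : ∀ m, 0 < u m) {π : Measure (Fin N → ℕ)}
    (h : G.IsStationary d lam u π) (l : ℕ) :
    ∫ x, G.longRate u (l + 1) x ∂π ≤ G.load d lam u * ∫ x, G.longRate u l x ∂π := by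
  have := h.1
  have hI := fun l => G.integrable_longRate hu l π
  have step : ∀ R : ℕ, ∫ x, G.longRate u (l + 1) x ∂π ≤
      G.load d lam u * ∫ x, G.longRate u l x ∂π + ∫ x, G.longRate u (l + R + 1) x ∂π := by
    intro R
    have hb : ∀ x : Fin N → ℕ, |cappedExcess l R x| ≤ ∑ _j : Fin N, (R : ℝ) := fun x => by
      rw [abs_of_nonneg (Finset.sum_nonneg fun _ _ => Nat.cast_nonneg _)]
      exact Finset.sum_le_sum fun j _ => by exact_mod_cast min_le_right _ _
    obtain ⟨i, e⟩ := h.integral_rateOp G hb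
    have := integral_mono i ((((hI l).const_mul (G.load d lam u)).sub (hI (l + 1))).add
      (hI (l + R + 1))) fun x => G.rateOp_cappedExcess_le hlam hu l R x
    rw [e, integral_add' (((hI l).const_mul _).sub (hI (l + 1))) (hI (l + R + 1)),
      integral_sub' ((hI l).const_mul _) (hI (l + 1)), integral_const_mul] at this
    linarith
  have hlim : Tendsto (fun R : ℕ => G.load d lam u * ∫ x, G.longRate u l x ∂π +
      ∫ x, G.longRate u (l + R + 1) x ∂π) atTop
      (𝓝 (G.load d lam u * ∫ x, G.longRate u l x ∂π + 0)) := by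
    refine tendsto_const_nhds.add ((G.tendsto_integral_longRate hu π).comp ?_)
    exact tendsto_atTop_mono (fun R => by omega : ∀ R, R ≤ l + R + 1) tendsto_id
  rw [add_zero] at hlim
  exact ge_of_tendsto' hlim step

theorem IsStationary.integral_longRate_le {d : ℕ} {lam : ℝ} (hlam : 0 ≤ lam)
    {u : Fin M → ℝ} (hu : ∀ m, 0 < u m) {π : Measure (Fin N → ℕ)}
    (h : G.IsStationary d lam u π) {r : ℝ} (hr0 : 0 ≤ r) (hr : G.load d lam u ≤ r) (l : ℕ) :
    ∫ x, G.longRate u l x ∂π ≤ (∑ j, u (G.serverType j)) * r ^ l := by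
  have := h.1
  induction l with
  | zero =>
    have := integral_mono (G.integrable_longRate hu 0 π) (integrable_const (μ := π) _)
      (G.longRate_le hu 0)
    simpa using this
  | succ l ih =>
    calc _ ≤ G.load d lam u * ∫ x, G.longRate u l x ∂π := h.integral_longRate_succ_le G hlam hu l
      _ ≤ r * ∫ x, G.longRate u l x ∂π :=
        mul_le_mul_of_nonneg_right hr (integral_nonneg (G.longRate_nonneg hu l))
      _ ≤ r * ((∑ j, u (G.serverType j)) * r ^ l) := mul_le_mul_of_nonneg_left ih hr0
      _ = _ := by ring

/-! ### Existence of a stationary distribution -/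

/-- A strict upper bound for the total jump rate. -/
noncomputable def uniformRate (d : ℕ) (lam : ℝ) (u : Fin M → ℝ) : ℝ :=
  ∑ j, (‖G.arrivalRateBdd d lam j‖ + ‖G.departureRateBdd u j‖) + 1

theorem uniformRate_pos (d : ℕ) (lam : ℝ) (u : Fin M → ℝ) : 0 < G.uniformRate d lam u := by
  unfold uniformRate
  positivity

theorem sum_rate_le (d : ℕ) (lam : ℝ) (u : Fin M → ℝ) (x : Fin N → ℕ) :
    ∑ j, (G.arrivalRate d lam j x + G.departureRate u j x) ≤ G.uniformRate d lam u := by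
  refine le_trans (Finset.sum_le_sum fun j _ => add_le_add ?_ ?_)
    (le_add_of_nonneg_right zero_le_one)
  · exact (le_abs_self _).trans ((G.arrivalRateBdd d lam j).norm_coe_le_norm x)
  · exact (le_abs_self _).trans ((G.departureRateBdd u j).norm_coe_le_norm x)

/-- The transition operator of the uniformized chain. -/
noncomputable def step (d : ℕ) (lam : ℝ) (u : Fin M → ℝ) :
    ((Fin N → ℕ) → ℝ) →ₗ[ℝ] ((Fin N → ℕ) → ℝ) :=
  LinearMap.id + (G.uniformRate d lam u)⁻¹ • G.rateOp d lam u

theorem step_apply (d : ℕ) (lam : ℝ) (u : Fin M → ℝ) (f : (Fin N → ℕ) → ℝ) :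
    G.step d lam u f = f + (G.uniformRate d lam u)⁻¹ • G.rateOp d lam u f := rfl

theorem step_one (d : ℕ) (lam : ℝ) (u : Fin M → ℝ) : G.step d lam u 1 = 1 := by
  have : G.rateOp d lam u 1 = 0 := by
    funext x
    simp [rateOp_apply]
  rw [step_apply, this, smul_zero, add_zero]

/-- The uniformization rate bounds the total jump rate, so the weight of staying at `x` is
nonnegative. -/
theorem step_nonneg {d : ℕ} {lam : ℝ} (hlam : 0 ≤ lam) {u : Fin M → ℝ} (hu : ∀ m, 0 < u m)
    {f : (Fin N → ℕ) → ℝ} (hf : 0 ≤ f) : 0 ≤ G.step d lam u f := by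
  intro x
  have hΛ := G.uniformRate_pos d lam u
  have h1 : G.rateOp d lam u f x ≥
      -(∑ j, (G.arrivalRate d lam j x + G.departureRate u j x)) * f x := by
    rw [rateOp_apply, ← Finset.sum_neg_distrib, Finset.sum_mul]
    refine Finset.sum_le_sum fun j _ => ?_
    have h1 : 0 ≤ _ * f _ :=
      mul_nonneg (G.arrivalRate_nonneg (d := d) hlam j x) (hf (arrive j x))
    have h2 : 0 ≤ _ * f _ := mul_nonneg (G.departureRate_nonneg hu j x) (hf (depart j x))
    linarith
  have h2 := mul_le_mul_of_nonneg_right (G.sum_rate_le d lam u x) (hf x)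
  rw [step_apply]
  simp only [Pi.add_apply, Pi.smul_apply, smul_eq_mul, Pi.zero_apply]
  have h3 : -(G.uniformRate d lam u) * f x ≤ G.rateOp d lam u f x := by linarith
  have h4 := mul_le_mul_of_nonneg_left h3 (inv_nonneg.2 hΛ.le)
  rw [neg_mul, mul_neg, ← mul_assoc, inv_mul_cancel₀ hΛ.ne', one_mul] at h4
  linarith

/-- The average of `f` over the first `n + 1` steps of the uniformized chain started from the
empty state. -/
noncomputable def average (d : ℕ) (lam : ℝ) (u : Fin M → ℝ) (n : ℕ) :
    ((Fin N → ℕ) → ℝ) →ₗ[ℝ] ℝ :=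
  ((n : ℝ) + 1)⁻¹ • ∑ k ∈ Finset.range (n + 1), (LinearMap.proj 0).comp (G.step d lam u ^ k)

theorem average_apply (d : ℕ) (lam : ℝ) (u : Fin M → ℝ) (n : ℕ) (f : (Fin N → ℕ) → ℝ) :
    G.average d lam u n f =
      ((n : ℝ) + 1)⁻¹ * ∑ k ∈ Finset.range (n + 1), (G.step d lam u ^ k) f 0 := by
  simp [average, LinearMap.sum_apply]

theorem step_pow_nonneg {d : ℕ} {lam : ℝ} (hlam : 0 ≤ lam) {u : Fin M → ℝ} (hu : ∀ m, 0 < u m)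
    {f : (Fin N → ℕ) → ℝ} (hf : 0 ≤ f) (k : ℕ) : 0 ≤ (G.step d lam u ^ k) f := by
  induction k with
  | zero => simpa using hf
  | succ k ih =>
    rw [pow_succ', Module.End.mul_apply]
    exact G.step_nonneg hlam hu ih

theorem average_nonneg {d : ℕ} {lam : ℝ} (hlam : 0 ≤ lam) {u : Fin M → ℝ} (hu : ∀ m, 0 < u m)
    {f : (Fin N → ℕ) → ℝ} (hf : 0 ≤ f) (n : ℕ) : 0 ≤ G.average d lam u n f := by
  rw [average_apply]
  exact mul_nonneg (by positivity) (Finset.sum_nonneg fun k _ => G.step_pow_nonneg hlam hu hf k 0)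

theorem average_mono {d : ℕ} {lam : ℝ} (hlam : 0 ≤ lam) {u : Fin M → ℝ} (hu : ∀ m, 0 < u m)
    {f g : (Fin N → ℕ) → ℝ} (hfg : f ≤ g) (n : ℕ) :
    G.average d lam u n f ≤ G.average d lam u n g := by
  have := G.average_nonneg (d := d) hlam hu (sub_nonneg.2 hfg) n
  rwa [map_sub, sub_nonneg] at this

theorem step_pow_one (d : ℕ) (lam : ℝ) (u : Fin M → ℝ) (k : ℕ) : (G.step d lam u ^ k) 1 = 1 := by
  induction k with
  | zero => simp
  | succ k ih => rw [pow_succ', Module.End.mul_apply, ih, step_one]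

theorem abs_step_pow_le {d : ℕ} {lam : ℝ} (hlam : 0 ≤ lam) {u : Fin M → ℝ} (hu : ∀ m, 0 < u m)
    {f : (Fin N → ℕ) → ℝ} {b : ℝ} (hf : ∀ x, |f x| ≤ b) (k : ℕ) (x : Fin N → ℕ) :
    |(G.step d lam u ^ k) f x| ≤ b := by
  have h1 := G.step_pow_nonneg (d := d) hlam hu (f := b • 1 - f)
    (fun y => by simpa using (abs_le.1 (hf y)).2) k x
  have h2 := G.step_pow_nonneg (d := d) hlam hu (f := b • 1 + f)
    (fun y => by simpa [neg_le_iff_add_nonneg'] using (abs_le.1 (hf y)).1) k x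
  simp only [map_sub, map_add, map_smul, step_pow_one, Pi.zero_apply, Pi.sub_apply, Pi.add_apply,
    Pi.smul_apply, Pi.one_apply, smul_eq_mul, mul_one] at h1 h2
  exact abs_le.2 ⟨by linarith, by linarith⟩

theorem average_one (d : ℕ) (lam : ℝ) (u : Fin M → ℝ) (n : ℕ) : G.average d lam u n 1 = 1 := by
  rw [average_apply]
  simp only [step_pow_one, Pi.one_apply, Finset.sum_const, Finset.card_range, nsmul_eq_mul, mul_one]
  push_cast
  exact inv_mul_cancel₀ (by positivity)

theorem abs_average_le {d : ℕ} {lam : ℝ} (hlam : 0 ≤ lam) {u : Fin M → ℝ} (hu : ∀ m, 0 < u m)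
    {f g : (Fin N → ℕ) → ℝ} (hfg : ∀ x, |f x| ≤ g x) (n : ℕ) :
    |G.average d lam u n f| ≤ G.average d lam u n g := by
  refine abs_le.2 ⟨?_, G.average_mono hlam hu (fun x => (le_abs_self _).trans (hfg x)) n⟩
  rw [← map_neg]
  exact G.average_mono hlam hu (fun x => (abs_le.1 (hfg x)).1) n

/-- `rateOp` is a multiple of `step - 1`, so the sum telescopes. -/
theorem average_rateOp (d : ℕ) (lam : ℝ) (u : Fin M → ℝ) (n : ℕ) (f : (Fin N → ℕ) → ℝ) :
    G.average d lam u n (G.rateOp d lam u f) =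
      ((n : ℝ) + 1)⁻¹ * (G.uniformRate d lam u * ((G.step d lam u ^ (n + 1)) f 0 - f 0)) := by
  have h : G.rateOp d lam u f = G.uniformRate d lam u • (G.step d lam u f - f) := by
    rw [step_apply, add_sub_cancel_left, smul_inv_smul₀ (G.uniformRate_pos d lam u).ne']
  rw [average_apply, h]
  congr 1
  simp only [map_smul, map_sub, Pi.smul_apply, Pi.sub_apply, smul_eq_mul, ← Finset.mul_sum]
  congr 1
  have := Finset.sum_range_sub (fun k => (G.step d lam u ^ k) f 0) (n + 1)
  simpa only [pow_succ, Module.End.mul_apply, pow_zero, Module.End.one_apply] using this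

/-- No cap is needed here: the excess is nonnegative and zero at the empty initial state, so its
telescoped average drift is nonnegative. -/
theorem average_longRate_succ_le {d : ℕ} {lam : ℝ} (hlam : 0 ≤ lam) {u : Fin M → ℝ}
    (hu : ∀ m, 0 < u m) (n l : ℕ) :
    G.average d lam u n (G.longRate u (l + 1)) ≤
      G.load d lam u * G.average d lam u n (G.longRate u l) := by
  have h0 : 0 ≤ (excess l : (Fin N → ℕ) → ℝ) := fun x =>
    Finset.sum_nonneg fun _ _ => Nat.cast_nonneg _
  have h1 : (excess l : (Fin N → ℕ) → ℝ) 0 = 0 := by simp [excess]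
  have h2 : 0 ≤ G.average d lam u n (G.rateOp d lam u (excess l)) := by
    rw [average_rateOp, h1, sub_zero]
    exact mul_nonneg (by positivity) (mul_nonneg (G.uniformRate_pos d lam u).le
      (G.step_pow_nonneg hlam hu h0 _ 0))
  have h3 := G.average_mono (d := d) hlam hu
    (g := G.load d lam u • G.longRate u l - G.longRate u (l + 1))
    (fun x => G.rateOp_excess_le (d := d) hlam hu l x) n
  rw [map_sub, map_smul, smul_eq_mul] at h3
  linarith

theorem average_longRate_le {d : ℕ} {lam : ℝ} (hlam : 0 ≤ lam) {u : Fin M → ℝ}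
    (hu : ∀ m, 0 < u m) {r : ℝ} (hr0 : 0 ≤ r) (hr : G.load d lam u ≤ r) (n l : ℕ) :
    G.average d lam u n (G.longRate u l) ≤ (∑ j, u (G.serverType j)) * r ^ l := by
  induction l with
  | zero =>
    have h := G.average_mono (d := d) hlam hu
      (g := (∑ j, u (G.serverType j)) • 1) (f := G.longRate u 0)
      (fun x => by simpa using G.longRate_le hu 0 x) n
    rw [map_smul, average_one] at h
    simpa using h
  | succ l ih =>
    calc _ ≤ G.load d lam u * G.average d lam u n (G.longRate u l) :=
          G.average_longRate_succ_le hlam hu n l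
      _ ≤ r * G.average d lam u n (G.longRate u l) :=
        mul_le_mul_of_nonneg_right hr (G.average_nonneg hlam hu (G.longRate_nonneg hu l) n)
      _ ≤ r * ((∑ j, u (G.serverType j)) * r ^ l) := mul_le_mul_of_nonneg_left ih hr0
      _ = _ := by ring

/-- The states all of whose queues are shorter than `l`. -/
def box (N l : ℕ) : Finset (Fin N → ℕ) := Fintype.piFinset fun _ => Finset.range l

theorem tendsto_box (N : ℕ) : Tendsto (box N) atTop atTop := by
  refine tendsto_atTop_finset_of_monotone (fun l l' h => ?_) fun x => ?_
  · exact Fintype.piFinset_subset _ _ fun _ => Finset.range_subset_range.2 h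
  · refine ⟨∑ j, x j + 1, Fintype.mem_piFinset.2 fun j => Finset.mem_range.2 ?_⟩
    exact Nat.lt_succ_of_le (Finset.single_le_sum (fun _ _ => Nat.zero_le _) (Finset.mem_univ j))

theorem indicator_compl_box_le {u : Fin M → ℝ} (hu : ∀ m, 0 < u m) {c : ℝ} (hc : 0 < c)
    (hcu : ∀ m, c ≤ u m) (l : ℕ) (x : Fin N → ℕ) :
    ((box N l : Set (Fin N → ℕ))ᶜ).indicator (1 : (Fin N → ℕ) → ℝ) x ≤
      c⁻¹ * G.longRate u l x := by
  by_cases hx : x ∈ box N l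
  · simpa [hx] using mul_nonneg (inv_nonneg.2 hc.le) (G.longRate_nonneg hu l x)
  · rw [Set.indicator_of_mem (by simpa using hx), Pi.one_apply, ← div_eq_inv_mul, one_le_div hc]
    simp only [box, Fintype.mem_piFinset, Finset.mem_range, not_forall, not_lt] at hx
    obtain ⟨j, hj⟩ := hx
    refine (hcu (G.serverType j)).trans
      (Finset.single_le_sum (f := fun j => u (G.serverType j)) (fun _ _ => (hu _).le) ?_)
    simpa [longQueues] using hj

theorem exists_pos_le {u : Fin M → ℝ} (hu : ∀ m, 0 < u m) : ∃ c, 0 < c ∧ ∀ m, c ≤ u m := by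
  rcases isEmpty_or_nonempty (Fin M) with h | h
  · exact ⟨1, one_pos, fun m => h.elim m⟩
  · obtain ⟨m, hm⟩ := Finite.exists_min u
    exact ⟨u m, hu m, hm⟩

/-- A Krylov–Bogoliubov argument. The limit `φ` of the averages is a priori only finitely additive;
the geometric bound on `longRate` prevents loss of mass at infinity and makes `φ` integration
against the weights `p`. -/
theorem exists_isStationary {d : ℕ} {lam : ℝ} (hlam : 0 ≤ lam) {u : Fin M → ℝ}
    (hu : ∀ m, 0 < u m) (hload : G.load d lam u < 1) :
    ∃ π : Measure (Fin N → ℕ), G.IsStationary d lam u π := by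
  obtain ⟨c, hc, hcu⟩ := exists_pos_le hu
  set U := hyperfilter ℕ
  -- limits of the averages along an ultrafilter
  have hex : ∀ f : (Fin N → ℕ) → ℝ, ∃ a, (∃ b, ∀ x, |f x| ≤ b) →
      Tendsto (fun n => G.average d lam u n f) U (𝓝 a) := by
    intro f
    by_cases hf : ∃ b, ∀ x, |f x| ≤ b
    · obtain ⟨b, hb⟩ := hf
      obtain ⟨a, -, ha⟩ := (isCompact_Icc (a := -b) (b := b)).ultrafilter_le_nhds
        (U.map fun n => G.average d lam u n f) (by
          refine tendsto_principal.2 (Eventually.of_forall fun n => abs_le.1 ?_)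
          have := G.abs_average_le (d := d) hlam hu (g := b • 1) (fun x => by simpa using hb x) n
          rw [map_smul, average_one] at this
          simpa using this)
      exact ⟨a, fun _ => ha⟩
    -- A default value making `φ` total; nothing is claimed for unbounded `f`.
    · exact ⟨0, fun h => absurd h hf⟩
  choose φ hφ using hex
  set r := max (G.load d lam u) 0
  have hr0 : 0 ≤ r := le_max_right _ _
  have hr1 : r < 1 := max_lt hload one_pos
  set p : (Fin N → ℕ) → ℝ := fun x => φ (Pi.single x 1)
  have hsb : ∀ x : Fin N → ℕ, ∃ b, ∀ y, |(Pi.single x 1 : (Fin N → ℕ) → ℝ) y| ≤ b := fun x =>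
    ⟨1, fun y => by
      rw [Pi.single_apply]
      split_ifs <;> simp⟩
  have hsum : ∀ (f : (Fin N → ℕ) → ℝ) (F : Finset (Fin N → ℕ)),
      Tendsto (fun n => G.average d lam u n (∑ x ∈ F, f x • Pi.single x 1)) U
        (𝓝 (∑ x ∈ F, f x * p x)) := by
    intro f F
    simp only [map_sum, map_smul, smul_eq_mul]
    exact tendsto_finsetSum _ fun x _ => (hφ _ (hsb x)).const_mul _
  have hp0 : ∀ x, 0 ≤ p x := fun x => ge_of_tendsto' (hφ _ (hsb x)) fun n =>
    G.average_nonneg hlam hu (Pi.single_nonneg.2 zero_le_one) n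
  -- the sum over a box is almost the full limit
  have hbox : ∀ (f : (Fin N → ℕ) → ℝ) (b : ℝ), (∀ x, |f x| ≤ b) → ∀ l,
      |φ f - ∑ x ∈ box N l, f x * p x| ≤ b * (c⁻¹ * ((∑ j, u (G.serverType j)) * r ^ l)) := by
    intro f b hb l
    refine le_of_tendsto' ((hφ f ⟨b, hb⟩).sub (hsum f (box N l))).abs fun n => ?_
    rw [← map_sub]
    have hb0 : 0 ≤ b := (abs_nonneg _).trans (hb 0)
    refine (G.abs_average_le hlam hu (g := b • c⁻¹ • G.longRate u l) (fun x => ?_) n).trans ?_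
    · refine le_trans ?_ (mul_le_mul_of_nonneg_left (G.indicator_compl_box_le hu hc hcu l x) hb0)
      rw [Pi.sub_apply, Finset.sum_apply]
      by_cases hx : x ∈ box N l
      · simp [Pi.single_apply, hx]
      · simpa [Pi.single_apply, hx] using hb x
    · rw [map_smul, map_smul]
      exact mul_le_mul_of_nonneg_left (mul_le_mul_of_nonneg_left
        (G.average_longRate_le hlam hu hr0 (le_max_left _ _) n l) (inv_nonneg.2 hc.le)) hb0
  have hlim : ∀ (f : (Fin N → ℕ) → ℝ), (∃ b, ∀ x, |f x| ≤ b) →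
      Tendsto (fun l => ∑ x ∈ box N l, f x * p x) atTop (𝓝 (φ f)) := by
    rintro f ⟨b, hb⟩
    refine tendsto_iff_dist_tendsto_zero.2 (squeeze_zero (fun _ => dist_nonneg)
      (fun l => ?_) (?_ : Tendsto (fun l =>
        b * (c⁻¹ * ((∑ j, u (G.serverType j)) * r ^ l))) atTop (𝓝 0)))
    · rw [dist_comm, Real.dist_eq]
      exact hbox f b hb l
    · have := (((tendsto_pow_atTop_nhds_zero_of_lt_one hr0 hr1).const_mul
        (∑ j, u (G.serverType j))).const_mul c⁻¹).const_mul b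
      simpa using this
  have hone : ∃ b, ∀ x, |(1 : (Fin N → ℕ) → ℝ) x| ≤ b := ⟨1, fun x => by simp⟩
  have hφ1 : φ 1 = 1 := tendsto_nhds_unique (hφ 1 hone) (by simp [average_one])
  have hps : Summable p := by
    refine summable_of_sum_le hp0 (c := 1) fun F => ?_
    have h := hsum 1 F
    simp only [Pi.one_apply, one_mul, one_smul] at h
    refine le_of_tendsto' h fun n => ?_
    refine (G.average_mono hlam hu (fun x => ?_) n).trans_eq (G.average_one d lam u n)
    rw [Finset.sum_apply]
    by_cases hx : x ∈ F <;> simp [Pi.single_apply, hx]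
  have htsum : ∀ f : (Fin N → ℕ) → ℝ, (∃ b, ∀ x, |f x| ≤ b) → ∑' x, f x * p x = φ f := by
    rintro f ⟨b, hb⟩
    have hs : Summable fun x => f x * p x :=
      (hps.mul_left b).of_norm_bounded fun x => by
        rw [norm_mul, Real.norm_of_nonneg (hp0 x)]
        exact mul_le_mul_of_nonneg_right (hb x) (hp0 x)
    exact tendsto_nhds_unique (hs.hasSum.comp (tendsto_box N)) (hlim f ⟨b, hb⟩)
  have hp1 : ∑' x, p x = 1 := by simpa [hφ1] using htsum 1 hone
  have hpe : ∑' x, ENNReal.ofReal (p x) = 1 := by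
    rw [← ENNReal.ofReal_tsum_of_nonneg hp0 hps, hp1, ENNReal.ofReal_one]
  let q : PMF (Fin N → ℕ) := ⟨fun x => ENNReal.ofReal (p x), hpe ▸ ENNReal.summable.hasSum⟩
  refine ⟨q.toMeasure, G.isStationary_of_integral_generator fun f => ?_⟩
  rw [q.integral_eq_tsum _ (BoundedContinuousFunction.integrable _ _), coe_generator]
  have hLb : ∃ b, ∀ x, |G.rateOp d lam u f x| ≤ b :=
    ⟨‖G.generator d lam u f‖, fun x => by
      rw [← coe_generator]
      exact (G.generator d lam u f).norm_coe_le_norm x⟩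
  have hq : ∀ x, (q x).toReal = p x := fun x => ENNReal.toReal_ofReal (hp0 x)
  simp only [hq, smul_eq_mul, mul_comm (p _)]
  rw [htsum _ hLb]
  refine tendsto_nhds_unique (hφ _ hLb) ?_
  -- the averages of `rateOp f` tend to zero
  refine Tendsto.mono_left ?_ (Nat.hyperfilter_le_atTop)
  refine squeeze_zero_norm (a := fun n : ℕ => ((n : ℝ) + 1)⁻¹ *
    (G.uniformRate d lam u * (‖f‖ + ‖f‖))) (fun n => ?_) ?_
  · rw [average_rateOp, norm_mul, norm_mul, Real.norm_of_nonneg (by positivity),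
      Real.norm_of_nonneg (G.uniformRate_pos d lam u).le]
    refine mul_le_mul_of_nonneg_left (mul_le_mul_of_nonneg_left ?_
      (G.uniformRate_pos d lam u).le) (by positivity)
    exact (norm_sub_le _ _).trans (add_le_add (G.abs_step_pow_le hlam hu f.norm_coe_le_norm _ _) (f.norm_coe_le_norm 0))
  · have := (tendsto_one_div_add_atTop_nhds_zero_nat (𝕜 := ℝ)).mul_const
      (G.uniformRate d lam u * (‖f‖ + ‖f‖))
    simpa using this

end QueueSystem

/-! ### Compact sets of occupancies -/

/-- The occupancy states below a given envelope. -/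
def occupancyBox (M : ℕ) (b : Fin M × ℕ → ℝ) : Set (lp (fun _ : Fin M × ℕ => ℝ) 1) :=
  {q | q ∈ occupancySpace M ∧ ∀ i, q i ≤ b i}

/-- On the product of the intervals `[0, b i]`, compact by Tychonoff, the series `∑ q i • e i` in
`ℓ¹` converges uniformly by the Weierstrass test, so it is continuous for the product topology. The
constraints of `occupancySpace` are closed coordinatewise. -/
theorem isCompact_occupancyBox {M : ℕ} {b : Fin M × ℕ → ℝ} (hb : Summable b) :
    IsCompact (occupancyBox M b) := by
  classical
  let F : (Fin M × ℕ → ℝ) → lp (fun _ : Fin M × ℕ => ℝ) 1 := fun q =>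
    ∑' i, lp.single 1 i (q i)
  let P : Set (Fin M × ℕ → ℝ) := Set.univ.pi fun i => Set.Icc 0 (b i)
  let T : Set (Fin M × ℕ → ℝ) := {q | ∀ m : Fin M, q (m, 0) = 1 ∧ ∀ l : ℕ,
    q (m, l) ∈ Set.Icc (0 : ℝ) 1 ∧ q (m, l + 1) ≤ q (m, l)}
  have hP : IsCompact P := isCompact_univ_pi fun i => isCompact_Icc
  have hT : IsClosed T := by
    simp only [T, Set.ofPred_forall, Set.ofPred_and, Set.mem_Icc]
    refine isClosed_iInter fun m => (isClosed_eq (by fun_prop) (by fun_prop)).inter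
      (isClosed_iInter fun l => ((isClosed_le (by fun_prop) (by fun_prop)).inter
        (isClosed_le (by fun_prop) (by fun_prop))).inter (isClosed_le (by fun_prop) (by fun_prop)))
  have hF : ContinuousOn F P := by
    refine continuousOn_tsum (u := b) (fun i => ?_) hb fun i q hq => ?_
    · exact ((lp.isometry_single i).continuous.comp (continuous_apply i)).continuousOn
    · have h := hq i (Set.mem_univ i)
      rw [lp.norm_single one_pos, Real.norm_of_nonneg h.1]
      exact h.2
  convert (hP.inter_right hT).image_of_continuousOn (hF.mono Set.inter_subset_left) using 1
  have hFq : ∀ q : lp (fun _ : Fin M × ℕ => ℝ) 1, F q = q := fun q =>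
    (lp.hasSum_single ENNReal.one_ne_top q).tsum_eq
  ext q
  constructor
  · rintro ⟨hq, hqb⟩
    exact ⟨q, ⟨fun i _ => ⟨((hq i.1).2 i.2).1.1, hqb i⟩, hq⟩, hFq q⟩
  · rintro ⟨q', ⟨h1, h2⟩, rfl⟩
    have hmem : Memℓp q' 1 := by
      refine memℓp_gen (hb.of_nonneg_of_le (fun i => by positivity) fun i => ?_)
      have h := h1 i (Set.mem_univ i)
      simpa [abs_of_nonneg h.1] using h.2
    rw [hFq ⟨q', hmem⟩]
    exact ⟨h2, fun i => (h1 i (Set.mem_univ i)).2⟩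

/-! ### Tail bounds for the stationary occupancy, and tightness -/

namespace QueueSystem

variable {K M N : ℕ} (G : QueueSystem K M N)

theorem tailFraction_nonneg (x : Fin N → ℕ) (m : Fin M) (l : ℕ) : 0 ≤ G.tailFraction x m l :=
  mul_nonneg (by positivity) (Finset.sum_nonneg fun _ _ => by split_ifs <;> simp)

theorem occupancy_mem (hG : ∀ m, (G.serversOf m).Nonempty) (x : Fin N → ℕ) :
    G.occupancy x ∈ occupancySpace M := by
  intro m
  have hpos : (0 : ℝ) < (G.serversOf m).card := Nat.cast_pos.2 (hG m).card_pos
  refine ⟨?_, fun l => ⟨⟨G.tailFraction_nonneg x m l, ?_⟩, ?_⟩⟩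
  · change G.tailFraction x m 0 = 1
    simp [tailFraction, hpos.ne']
  · change G.tailFraction x m l ≤ 1
    rw [tailFraction, one_div, inv_mul_le_one₀ hpos]
    refine (Finset.sum_le_card_nsmul _ _ 1 fun j _ => ?_).trans (by simp)
    split_ifs <;> simp
  · refine mul_le_mul_of_nonneg_left (Finset.sum_le_sum fun j _ => ?_) (by positivity)
    dsimp only
    split_ifs
    · rfl
    · omega
    · exact zero_le_one
    · rfl

theorem tailFraction_le {u : Fin M → ℝ} (hu : ∀ m, 0 < u m) {c : ℝ} (hc : 0 < c)
    (hcu : ∀ m, c ≤ u m) (x : Fin N → ℕ) (m : Fin M) (l : ℕ) :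
    G.tailFraction x m l ≤ ((G.serversOf m).card : ℝ)⁻¹ * c⁻¹ * G.longRate u l x := by
  rw [tailFraction, one_div, mul_assoc]
  refine mul_le_mul_of_nonneg_left ?_ (by positivity)
  rw [← div_eq_inv_mul, le_div_iff₀ hc, Finset.sum_mul, longRate, longQueues, Finset.sum_filter]
  refine (Finset.sum_le_sum fun j _ => ?_).trans (Finset.sum_le_univ_sum_of_nonneg fun j => ?_)
  · split_ifs
    · rw [one_mul]
      exact hcu _
    · rw [zero_mul]
  · split_ifs
    exacts [(hu _).le, le_rfl]

/-- Markov's inequality for `longRate`. The total service rate is at most `D * N` and the type has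
at least `κ * N` servers, so `N` cancels. -/
theorem IsStationary.real_lt_tailFraction_le {d : ℕ} {lam : ℝ} (hlam : 0 ≤ lam)
    {u : Fin M → ℝ} (hu : ∀ m, 0 < u m) {π : Measure (Fin N → ℕ)}
    (h : G.IsStationary d lam u π) {r : ℝ} (hr0 : 0 ≤ r) (hr : G.load d lam u ≤ r)
    {c D κ : ℝ} (hc : 0 < c) (hcu : ∀ m, c ≤ u m) (huD : ∀ m, u m ≤ D) (hκ : 0 < κ)
    (hN : 1 ≤ N) (hκN : ∀ m, κ * N ≤ (G.serversOf m).card) (m : Fin M) (l : ℕ)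
    {t : ℝ} (ht : 0 < t) :
    π.real {x | t < G.tailFraction x m l} ≤ D / (c * κ) * r ^ l / t := by
  have := h.1
  have hN0 : (0 : ℝ) < N := by exact_mod_cast hN
  have hcard : (0 : ℝ) < (G.serversOf m).card := (mul_pos hκ hN0).trans_le (hκN m)
  have hI := (G.integrable_longRate hu l π).const_mul (((G.serversOf m).card : ℝ)⁻¹ * c⁻¹)
  have h1 : π.real {x | t < G.tailFraction x m l} ≤ π.real
      {x | t ≤ ((G.serversOf m).card : ℝ)⁻¹ * c⁻¹ * G.longRate u l x} :=
    measureReal_mono fun x hx => (le_of_lt hx).trans (G.tailFraction_le hu hc hcu x m l)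
  have h2 := mul_meas_ge_le_integral_of_nonneg (μ := π) (ae_of_all _ fun x =>
    (mul_nonneg (by positivity) (G.longRate_nonneg hu l x) :
      0 ≤ ((G.serversOf m).card : ℝ)⁻¹ * c⁻¹ * G.longRate u l x)) hI t
  rw [integral_const_mul] at h2
  rw [le_div_iff₀' ht]
  refine (mul_le_mul_of_nonneg_left h1 ht.le).trans (h2.trans ?_)
  have hsum : ∑ j, u (G.serverType j) ≤ D * N := by
    refine (Finset.sum_le_card_nsmul _ _ D fun j _ => huD _).trans_eq ?_
    simp [mul_comm]
  have hD : 0 ≤ D := (hu m).le.trans (huD m)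
  calc _ ≤ ((G.serversOf m).card : ℝ)⁻¹ * c⁻¹ * (D * N * r ^ l) := by
        refine mul_le_mul_of_nonneg_left ?_ (by positivity)
        exact (h.integral_longRate_le G hlam hu hr0 hr l).trans
          (mul_le_mul_of_nonneg_right hsum (by positivity))
    _ ≤ (κ * N)⁻¹ * c⁻¹ * (D * N * r ^ l) := by
        gcongr
        exact hκN m
    _ = _ := by field_simp

/-- Union bound over types and levels: the thresholds `B * s ^ l` with `s > r` leave a geometric
series of ratio `r / s`, and the factor `1 / B` makes it small. -/
theorem IsStationary.real_occupancy_notMem_le {d : ℕ} {lam : ℝ} (hlam : 0 ≤ lam)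
    {u : Fin M → ℝ} (hu : ∀ m, 0 < u m) {π : Measure (Fin N → ℕ)}
    (h : G.IsStationary d lam u π) {r : ℝ} (hr0 : 0 ≤ r) (hr : G.load d lam u ≤ r)
    {c D κ : ℝ} (hc : 0 < c) (hcu : ∀ m, c ≤ u m) (hD : 0 ≤ D) (huD : ∀ m, u m ≤ D) (hκ : 0 < κ)
    (hN : 1 ≤ N) (hκN : ∀ m, κ * N ≤ (G.serversOf m).card)
    (hG : ∀ m, (G.serversOf m).Nonempty) {s B : ℝ} (hrs : r < s) (hB : 0 < B) :
    π.real {x | G.occupancy x ∉ occupancyBox M fun i => B * s ^ i.2} ≤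
      M * (D / (c * κ) / B) * (1 - r / s)⁻¹ := by
  have := h.1
  have hs : 0 < s := hr0.trans_lt hrs
  have hθ0 : 0 ≤ r / s := by positivity
  have hθ1 : r / s < 1 := (div_lt_one hs).2 hrs
  have hsub : {x | G.occupancy x ∉ occupancyBox M fun i => B * s ^ i.2} ⊆
      ⋃ l : ℕ, ⋃ m : Fin M, {x | B * s ^ l < G.tailFraction x m l} := by
    intro x hx
    simp only [Set.mem_ofPred_eq, occupancyBox, G.occupancy_mem hG, true_and, not_forall,
      not_le] at hx
    obtain ⟨⟨m, l⟩, hml⟩ := hx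
    exact Set.mem_iUnion₂.2 ⟨l, m, hml⟩
  have hl : ∀ l : ℕ, π (⋃ m : Fin M, {x | B * s ^ l < G.tailFraction x m l}) ≤
      ENNReal.ofReal (M * (D / (c * κ) / B) * (r / s) ^ l) := fun l => by
    rw [← ofReal_measureReal]
    refine ENNReal.ofReal_le_ofReal ((measureReal_iUnion_fintype_le _).trans ?_)
    refine (Finset.sum_le_card_nsmul _ _ (D / (c * κ) * r ^ l / (B * s ^ l)) fun m _ =>
      h.real_lt_tailFraction_le G hlam hu hr0 hr hc hcu huD hκ hN hκN m l
        (by positivity)).trans_eq ?_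
    rw [Finset.card_univ, Fintype.card_fin, nsmul_eq_mul, div_pow]
    field_simp
  have hgeom := (hasSum_geometric_of_lt_one hθ0 hθ1).mul_left (M * (D / (c * κ) / B))
  refine ENNReal.toReal_le_of_le_ofReal
    (mul_nonneg (by positivity) (inv_nonneg.2 (sub_nonneg.2 hθ1.le))) ?_
  refine (measure_mono hsub).trans ((measure_iUnion_le _).trans
    ((ENNReal.tsum_le_tsum hl).trans_eq ?_))
  rw [← ENNReal.ofReal_tsum_of_nonneg (fun l => by positivity) hgeom.summable, hgeom.tsum_eq]

theorem real_occupancy_notMem_mono (π : Measure (Fin N → ℕ)) [IsProbabilityMeasure π]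
    {C C' : Set (lp (fun _ : Fin M × ℕ => ℝ) 1)} (h : C ⊆ C') :
    π.real {x | G.occupancy x ∉ C'} ≤ π.real {x | G.occupancy x ∉ C} :=
  measureReal_mono fun _ hx hxC => hx (h hxC)

/-- Tightness for a single system. -/
theorem exists_isCompact_occupancy {d : ℕ} {lam : ℝ} (hlam : 0 ≤ lam) {u : Fin M → ℝ}
    (hu : ∀ m, 0 < u m) {ε : ℝ} (hε : 0 < ε) :
    ∃ C : Set (lp (fun _ : Fin M × ℕ => ℝ) 1), IsCompact C ∧ C ⊆ occupancySpace M ∧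
      ((∀ m, (G.serversOf m).Nonempty) → ∀ π : Measure (Fin N → ℕ), G.IsStationary d lam u π →
        π.real {x | G.occupancy x ∉ C} < ε) := by
  by_cases hG : (∀ m, (G.serversOf m).Nonempty) ∧
      ∃ π : Measure (Fin N → ℕ), G.IsStationary d lam u π
  swap
  · exact ⟨∅, isCompact_empty, Set.empty_subset _, fun h π hπ => absurd ⟨h, π, hπ⟩ hG⟩
  obtain ⟨hG, π, hπ⟩ := hG
  have := hπ.1
  have hs := hasSum_measureReal_singleton_mul (integrable_const (μ := π) (1 : ℝ))
  simp only [mul_one, integral_const, probReal_univ, smul_eq_mul] at hs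
  -- A finite set of states carries mass above `1 - ε`; by uniqueness it serves every stationary
  -- law.
  obtain ⟨F, hF⟩ := (hs.eventually (lt_mem_nhds (by linarith : 1 - ε < 1))).exists
  refine ⟨G.occupancy '' F, (F.finite_toSet.image _).isCompact, ?_, fun _ π' hπ' => ?_⟩
  · rintro _ ⟨x, -, rfl⟩
    exact G.occupancy_mem hG x
  · rw [hπ'.eq G hlam hu hπ]
    have h1 : π.real {x | G.occupancy x ∉ G.occupancy '' F} ≤ π.real (F : Set (Fin N → ℕ))ᶜ :=
      measureReal_mono fun x hx hxF => hx ⟨x, hxF, rfl⟩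
    rw [sum_measureReal_singleton] at hF
    rw [probReal_compl_eq_one_sub F.measurableSet] at h1
    linarith

end QueueSystem

theorem mainTheorem6 (K M d : ℕ) (hd : 2 ≤ d) (lam ξ ρ : ℝ) (hlam : 0 < lam) (hξ : 0 < ξ)
    (w : Fin K → ℝ) (hw : ∀ k, 0 < w k)
    (v : Fin M → ℝ) (hv : ∀ m, 0 < v m)
    (u : Fin M → ℝ) (hu : ∀ m, 0 < u m)
    (hcap : lam * ξ < ∑ m, u m * v m)
    (G : ∀ N : ℕ, QueueSystem K M N)
    (hW : Tendsto (fun N : ℕ => ((G N).W : ℝ) / (N : ℝ)) atTop (𝓝 ξ))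
    (hWk : ∀ k, Tendsto (fun N : ℕ => (((G N).dispatchersOf k).card : ℝ) / ((G N).W : ℝ))
      atTop (𝓝 (w k)))
    (hVm : ∀ m, Tendsto (fun N : ℕ => (((G N).serversOf m).card : ℝ) / (N : ℝ))
      atTop (𝓝 (v m)))
    (hload : Tendsto (fun N : ℕ => (G N).load d lam u) atTop (𝓝 ρ)) (hρ : ρ < 1) :
    -- the steady state exists and is unique for every `N` with `ρ^N < 1`, so for all large `N`
    (∀ N : ℕ, 1 ≤ N → (G N).load d lam u < 1 →
      ∃! π : Measure (Fin N → ℕ), (G N).IsStationary d lam u π) ∧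
    -- tightness of the stationary occupancies
    ∀ ε : ℝ, 0 < ε →
      ∃ C : Set (lp (fun _ : Fin M × ℕ => ℝ) 1), IsCompact C ∧ C ⊆ occupancySpace M ∧
        ∀ N : ℕ, 1 ≤ N → (∀ m, ((G N).serversOf m).Nonempty) →
          ∀ π : Measure (Fin N → ℕ), (G N).IsStationary d lam u π →
            π.real {x | (G N).occupancy x ∉ C} < ε := by
  have hlam0 := hlam.le
  refine ⟨fun N _ hN => ?_, fun ε hε => ?_⟩
  · obtain ⟨π, hπ⟩ := (G N).exists_isStationary hlam0 hu hN
    exact ⟨π, hπ, fun π' hπ' => hπ'.eq (G N) hlam0 hu hπ⟩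
  obtain ⟨c, hc, hcu⟩ := QueueSystem.exists_pos_le hu
  -- Half the limiting proportions leave room for `κ * N` to be a lower bound for all large `N`.
  obtain ⟨κ, hκ, hκv⟩ := QueueSystem.exists_pos_le (fun m => half_pos (hv m))
  set D : ℝ := ∑ m, u m + 1
  have huD : ∀ m, u m ≤ D := fun m =>
    (Finset.single_le_sum (fun m _ => (hu m).le) (Finset.mem_univ m)).trans
      (le_add_of_nonneg_right zero_le_one)
  have hD : 0 < D := add_pos_of_nonneg_of_pos (Finset.sum_nonneg fun m _ => (hu m).le) one_pos
  set r : ℝ := max ((ρ + 1) / 2) 0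
  have hr0 : 0 ≤ r := le_max_right _ _
  have hr1 : r < 1 := max_lt (by linarith) one_pos
  -- Strictly between `r` and 1: `s < 1` makes the envelope summable, `r < s` makes the union bound
  -- converge.
  set s : ℝ := (r + 1) / 2 with hs
  have hrs : r < s := by linarith
  have hs0 : 0 < s := hr0.trans_lt hrs
  have hs1 : s < 1 := by linarith
  have hθ : 0 < 1 - r / s := sub_pos.2 ((div_lt_one hs0).2 hrs)
  -- Chosen so that the union bound equals `M / (M + 1) * ε < ε`; the `+ 1` also keeps `B` positive
  -- when `M = 0`.
  set B : ℝ := (M + 1) * (D / (c * κ)) * (1 - r / s)⁻¹ / ε with hBdef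
  have hB : 0 < B := by positivity
  have hlarge : ∀ᶠ N in atTop, (G N).load d lam u ≤ r ∧
      ∀ m, κ * N ≤ ((G N).serversOf m).card := by
    refine ((hload.eventually (gt_mem_nhds (by linarith : ρ < (ρ + 1) / 2))).mono fun N hN =>
      hN.le.trans (le_max_left _ _)).and (eventually_all.2 fun m => ?_)
    filter_upwards [(hVm m).eventually (lt_mem_nhds (half_lt_self (hv m))),
      eventually_gt_atTop 0] with N hN hN0
    exact (le_div_iff₀ (Nat.cast_pos.2 hN0)).1 ((hκv m).trans hN.le)
  obtain ⟨N₀, hN₀⟩ := eventually_atTop.1 hlarge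
  choose C hC hCS hCε using fun N => (G N).exists_isCompact_occupancy (d := d) hlam0 hu hε
  have hsum : Summable fun i : Fin M × ℕ => B * s ^ i.2 :=
    ((hasSum_fintype fun _ : Fin M => B).summable).mul_of_nonneg
      (summable_geometric_of_lt_one hs0.le hs1) (fun _ => hB.le) (fun _ => by positivity)
  refine ⟨occupancyBox M (fun i => B * s ^ i.2) ∪ ⋃ N ∈ Finset.range N₀, C N,
    (isCompact_occupancyBox hsum).union ((Finset.range N₀).isCompact_biUnion fun N _ => hC N),
    Set.union_subset (fun q hq => hq.1) (Set.iUnion₂_subset fun N _ => hCS N),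
    fun N hN hG π hπ => ?_⟩
  have := hπ.1
  rcases lt_or_ge N N₀ with h | h
  · exact ((G N).real_occupancy_notMem_mono π (Set.subset_union_of_subset_right
      (Set.subset_biUnion_of_mem (Finset.mem_coe.2 (Finset.mem_range.2 h))) _)).trans_lt
      (hCε N hG π hπ)
  · obtain ⟨h1, h2⟩ := hN₀ N h
    refine ((G N).real_occupancy_notMem_mono π Set.subset_union_left).trans_lt
      ((hπ.real_occupancy_notMem_le (G N) hlam0 hu hr0 h1 hc hcu hD.le huD hκ hN h2 hG hrs
        hB).trans_lt ?_)
    have hA : 0 < D / (c * κ) := by positivity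
    have : (M : ℝ) * (D / (c * κ) / B) * (1 - r / s)⁻¹ = M / (M + 1) * ε := by
      have hsr : s - r ≠ 0 := (sub_pos.2 hrs).ne'
      rw [hBdef]
      field_simp
    rw [this]
    exact mul_lt_of_lt_one_left hε ((div_lt_one (by positivity)).2 (lt_add_one _))
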